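/- Let $d\ge 1$ and let $\mathcal H$ be a separable complex Hilbert space. Let $\mathcal F=\mathcal H\otimes\mathcal F_{\mathrm b}$, where $\mathcal F_{\mathrm b}$ is the boson Fock space over $L^2(\mathbb R^d)$; identify $\mathcal F$ with $\bigoplus_{n\ge 0}L^2_{\mathrm{sym}}((\mathbb R^d)^n;\mathcal H)$. Let $A$ be a self-adjoint operator in $\mathcal H$ bounded from below, and let $\omega:\mathbb R^d\to[0,\infty)$ be continuous with $\omega(k)>0$ for $k\neq 0$ and $\inf_{|k|>\varepsilon}\omega(k)>0$ for every $\varepsilon>0$. Put $H_0=A\otimes I+I\otimes d\Gamma(\omega)$ on $D(A\otimes I)\cap D(I\otimes d\Gamma(\omega))$ and $N=I\otimes d\Gamma(1)$; for $f\in L^2(\mathbb R^d)$ let $a(f)$ be the annihilation operator $(a(f)\Psi)^{(n)}(k_1,\dots,k_n)=\sqrt{n+1}\int\overline{f(q)}\,\Psi^{(n+1)}(q,k_1,\dots,k_n)\,dq$ on its maximal domain. Let $H_{\mathrm{QFT}}=H_0+H_{\mathrm I}$ be self-adjoint with $D(H_{\mathrm{QFT}})=D(H_0)$, and let $\Psi_{\mathrm{QFT}}$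 be a normalized ground state: $\sigma(H_{\mathrm{QFT}})$ is bounded below, $\|\Psi_{\mathrm{QFT}}\|=1$ and $H_{\mathrm{QFT}}\Psi_{\mathrm{QFT}}=E_0\Psi_{\mathrm{QFT}}$ with $E_0=\inf\sigma(H_{\mathrm{QFT}})$. Put $\widehat H=H_{\mathrm{QFT}}-E_0$. For every $k\in\mathbb R^d\setminus\{0\}$ let $B_{\mathrm{PT}}(k)$ be an operator in $\mathcal F$ with $D(B_{\mathrm{PT}}(k))\supset D(H_0)$ such that: (1) $k\mapsto(\Phi,B_{\mathrm{PT}}(k)\Psi)$ is measurable for all $\Psi\in D(H_0)$ and $\Phi\in\mathcal F$, and for every $f\in C_0^\infty(\mathbb R^d\setminus\{0\})$ one has $\Psi_{\mathrm{QFT}}\in D(a(f))$ and $a(f)\Psi_{\mathrm{QFT}}=-\int\overline{f(k)}\,(\widehat H+\omega(k))^{-1}B_{\mathrm{PT}}(k)\Psi_{\mathrm{QFT}}\,dk$; (2) $(\widehat H+\omega(k))^{-1}B_{\mathrm{PT}}(k)$ is bounded for every $k\ne0$, and $M_\varepsilon:=\big(\int_{|k|>\varepsilon}\|(\widehat H+\omega(k))^{-1}B_{\mathrm{PT}}(k)\|^2dk\big)^{1/2}<\infty$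 for every $\varepsilon>0$. Let $K_{\mathrm{PT}}(k)=(\widehat H+\omega(k))^{-1}B_{\mathrm{PT}}(k)\Psi_{\mathrm{QFT}}$ for $k\neq0$, and let $T_{\mathrm{PT}}:\mathcal F\to L^2(\mathbb R^d)$ be the maximal Carleman operator induced by $K_{\mathrm{PT}}$: $D(T_{\mathrm{PT}})=\{\Phi\in\mathcal F:(K_{\mathrm{PT}}(\cdot),\Phi)\in L^2(\mathbb R^d)\}$ and $(T_{\mathrm{PT}}\Phi)(k)=(K_{\mathrm{PT}}(k),\Phi)$. Then the following are equivalent: (i) $\Psi_{\mathrm{QFT}}\in D(N^{1/2})$; (ii) $\|K_{\mathrm{PT}}(\cdot)\|_{\mathcal F}\in L^2(\mathbb R^d)$; (iii) $T_{\mathrm{PT}}$ is a Hilbert–Schmidt operator (everywhere defined, bounded, and $\sum_i\|T_{\mathrm{PT}}e_i\|^2<\infty$ for an orthonormal basis $(e_i)$ of $\mathcal F$). If they hold, then the limit $M_0:=\lim_{\varepsilon\downarrow0}M_\varepsilon$ exists in $[0,\infty]$, $\|T_{\mathrm{PT}}\|\le M_0$, and $\|T_{\mathrm{PT}}\|<\infty$.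 -/

import Mathlib

open MeasureTheory Filter Topology
open scoped ENNReal ComplexConjugate

namespace QFT

noncomputable section

/-! ### Unbounded operators -/

section Operators

variable {F G : Type*} [NormedAddCommGroup F] [InnerProductSpace ℂ F]
  [NormedAddCommGroup G] [InnerProductSpace ℂ G]

/-- The value `S x` of a partially defined operator. It is only used for `x` in the domain of `S`;
outside the domain the value is the dummy `0`. -/
def applyPMap (S : F →ₗ.[ℂ] G) (x : F) : G :=
  open Classical in if h : x ∈ S.domain then S ⟨x, h⟩ else 0

/-- A partially defined operator is bounded: `‖S x‖ ≤ C ‖x‖` on its domain. -/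
def IsBddPMap (S : F →ₗ.[ℂ] G) : Prop :=
  ∃ C : ℝ, ∀ x : S.domain, ‖S x‖ ≤ C * ‖(x : F)‖

/-- The operator norm, with values in `[0, ∞]`: the supremum of `‖S x‖` over the `x` in the domain
with `‖x‖ ≤ 1`. For a bounded densely defined operator it is also the norm of the continuous
extension to the whole space. -/
def opENorm (S : F →ₗ.[ℂ] G) : ℝ≥0∞ :=
  ⨆ (x : S.domain) (_ : ‖(x : F)‖ ≤ 1), ‖S x‖ₑ

/-- `R` is a bounded everywhere defined two-sided inverse of `S - z`. -/
def IsResolventAt (S : F →ₗ.[ℂ] F) (z : ℂ) (R : F →L[ℂ] F) : Prop :=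
  (∀ y : F, ∃ h : R y ∈ S.domain, S ⟨R y, h⟩ - z • R y = y) ∧
    ∀ x : S.domain, R (S x - z • (x : F)) = x

/-- The spectrum of a (closed) partially defined operator. -/
def pmapSpectrum (S : F →ₗ.[ℂ] F) : Set ℂ :=
  {z | ¬ ∃ R : F →L[ℂ] F, IsResolventAt S z R}

/-- The resolvent `(S - z)⁻¹` (the dummy `0` if `z` is in the spectrum). -/
def resolventAt (S : F →ₗ.[ℂ] F) (z : ℂ) : F →L[ℂ] F :=
  open Classical in if h : ∃ R : F →L[ℂ] F, IsResolventAt S z R then h.choose else 0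

/-- The real points of the spectrum; for a self-adjoint operator this is the whole spectrum. -/
def realSpectrum (S : F →ₗ.[ℂ] F) : Set ℝ := {x | (x : ℂ) ∈ pmapSpectrum S}

/-- The ground state energy `inf σ(S)`. -/
def groundEnergy (S : F →ₗ.[ℂ] F) : ℝ := sInf (realSpectrum S)

/-- `Ψ` is a normalized ground state of `S`: the spectrum is bounded below, and `Ψ` is a unit
eigenvector with eigenvalue `inf σ(S)`. -/
structure IsGroundState (S : F →ₗ.[ℂ] F) (Ψ : F) : Prop where
  bddBelow : BddBelow (realSpectrum S)
  norm_eq_one : ‖Ψ‖ = 1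
  eigen : ∃ h : Ψ ∈ S.domain, S ⟨Ψ, h⟩ = (groundEnergy S : ℂ) • Ψ

/-- The operator is bounded below as a quadratic form. -/
def IsSemibounded (S : F →ₗ.[ℂ] F) : Prop :=
  ∃ c : ℝ, ∀ x : S.domain, c * ‖(x : F)‖ ^ 2 ≤ (inner ℂ (x : F) (S x)).re

/-- Hilbert-Schmidt operators: everywhere defined, bounded, and `∑ ‖T e‖² < ∞` over some complete
orthonormal system. -/
def IsHilbertSchmidt (T : F →ₗ.[ℂ] G) : Prop :=
  T.domain = ⊤ ∧ IsBddPMap T ∧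
    ∃ (w : Set F) (b : HilbertBasis w ℂ F), Summable fun i => ‖applyPMap T (b i)‖ ^ 2

end Operators

/-! ### The state space -/

/-- The momentum space `ℝ^d`. -/
abbrev Mom (d : ℕ) : Type := EuclideanSpace ℝ (Fin d)

section FockSpace

variable (d : ℕ) (H : Type*) [NormedAddCommGroup H] [InnerProductSpace ℂ H]

theorem measurePreserving_perm {d n : ℕ} (σ : Equiv.Perm (Fin n)) :
    MeasurePreserving (fun k : Fin n → Mom d => k ∘ σ) volume volume := by
  have e : (fun k : Fin n → Mom d => k ∘ σ)
      = MeasurableEquiv.piCongrLeft (fun _ : Fin n => Mom d) σ.symm := by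
    funext k i
    simp [MeasurableEquiv.coe_piCongrLeft, Equiv.piCongrLeft_apply]
  rw [e]
  exact volume_measurePreserving_piCongrLeft (fun _ : Fin n => Mom d) σ.symm

/-- The closed subspace `L²_sym((ℝ^d)^n; H)` of permutation symmetric functions
in `L²((ℝ^d)^n; H)`; for `n = 0` this is `H`. -/
def symL2 (n : ℕ) : Submodule ℂ (Lp H 2 (volume : Measure (Fin n → Mom d))) where
  carrier := {f | ∀ σ : Equiv.Perm (Fin n), (fun k => f (k ∘ σ)) =ᵐ[volume] f}
  zero_mem' := by
    intro σ
    have hz := Lp.coeFn_zero H 2 (volume : Measure (Fin n → Mom d))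
    have hσ := (measurePreserving_perm (d := d) σ).quasiMeasurePreserving.ae_eq_comp hz
    filter_upwards [hz, hσ] with k h1 h2
    simp only [Function.comp_apply, Pi.zero_apply] at h1 h2
    rw [h1, h2]
  add_mem' := by
    intro f g hf hg σ
    have hz := Lp.coeFn_add f g
    have hσ := (measurePreserving_perm (d := d) σ).quasiMeasurePreserving.ae_eq_comp hz
    filter_upwards [hz, hσ, hf σ, hg σ] with k h1 h2 h3 h4
    simp only [Function.comp_apply, Pi.add_apply] at h1 h2
    rw [h1, h2, h3, h4]
  smul_mem' := by
    intro c f hf σ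
    have hz := Lp.coeFn_smul c f
    have hσ := (measurePreserving_perm (d := d) σ).quasiMeasurePreserving.ae_eq_comp hz
    filter_upwards [hz, hσ, hf σ] with k h1 h2 h3
    simp only [Function.comp_apply, Pi.smul_apply] at h1 h2
    rw [h1, h2, h3]

theorem isClosed_symL2 (n : ℕ) :
    IsClosed (symL2 d H n : Set (Lp H 2 (volume : Measure (Fin n → Mom d)))) := by
  have : (symL2 d H n : Set (Lp H 2 (volume : Measure (Fin n → Mom d)))) =
      ⋂ σ : Equiv.Perm (Fin n),
        {f | Lp.compMeasurePreserving _ (measurePreserving_perm (d := d) σ) f = f} := by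
    ext f
    simp only [Set.mem_iInter, Set.mem_ofPred_eq]
    refine forall_congr' fun σ => ?_
    have h := Lp.coeFn_compMeasurePreserving f (measurePreserving_perm (d := d) σ)
    constructor
    · intro hf
      exact Lp.ext (h.trans hf)
    · intro hf
      rw [hf] at h
      exact h.symm
  rw [this]
  exact isClosed_iInter fun σ =>
    isClosed_eq (Lp.isometry_compMeasurePreserving _).continuous continuous_id

instance instCompleteSymL2 [CompleteSpace H] (n : ℕ) : CompleteSpace (symL2 d H n) :=
  (isClosed_symL2 d H n).completeSpace_coe

/-- The state space `H ⊗ F_b(L²(ℝ^d))`, in its standard realization as the Hilbert space direct sum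
`⨁ₙ L²_sym((ℝ^d)^n; H)`; a tensor `u ⊗ ψ` is the sequence of functions `k ↦ ψ⁽ⁿ⁾(k) u`. -/
abbrev Fock : Type _ := lp (fun n : ℕ => symL2 d H n) 2

variable {d H}

/-- The `n`-boson component of `Ψ`, as an `H`-valued function of `n` momenta. -/
def comp (Ψ : Fock d H) (n : ℕ) : (Fin n → Mom d) → H :=
  ((Ψ n : symL2 d H n) : Lp H 2 (volume : Measure (Fin n → Mom d)))

theorem comp_zero (n : ℕ) : comp (0 : Fock d H) n =ᵐ[volume] 0 :=
  Lp.coeFn_zero H 2 (volume : Measure (Fin n → Mom d))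

theorem comp_add (Ψ Φ : Fock d H) (n : ℕ) :
    comp (Ψ + Φ) n =ᵐ[volume] comp Ψ n + comp Φ n :=
  Lp.coeFn_add (p := 2) (μ := (volume : Measure (Fin n → Mom d))) _ _

theorem comp_smul (c : ℂ) (Ψ : Fock d H) (n : ℕ) :
    comp (c • Ψ) n =ᵐ[volume] c • comp Ψ n :=
  Lp.coeFn_smul (p := 2) (μ := (volume : Measure (Fin n → Mom d))) _ _

theorem ext_comp {Ψ Φ : Fock d H} (h : ∀ n, comp Ψ n =ᵐ[volume] comp Φ n) : Ψ = Φ := by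
  apply lp.ext
  funext n
  exact Subtype.ext (Lp.ext (h n))

theorem memLp_comp (Ψ : Fock d H) (n : ℕ) : MemLp (comp Ψ n) 2 volume :=
  Lp.memLp _

/-! ### Operators on the state space -/

/-- The graph of `A ⊗ I`: the operator `A` acts on the values, `(A Ψ)⁽ⁿ⁾(k) = A (Ψ⁽ⁿ⁾(k))`. -/
def tensorIdGraph (A : H →ₗ.[ℂ] H) : Submodule ℂ (Fock d H × Fock d H) where
  carrier := {p | ∀ n, ∀ᵐ k, (comp p.1 n k, comp p.2 n k) ∈ A.graph}
  zero_mem' := by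
    intro n
    filter_upwards [comp_zero (d := d) (H := H) n] with k h
    simp only [Prod.fst_zero, Prod.snd_zero, h]
    exact A.graph.zero_mem
  add_mem' := by
    intro p q hp hq n
    filter_upwards [hp n, hq n, comp_add p.1 q.1 n, comp_add p.2 q.2 n] with k h1 h2 h3 h4
    simp only [Prod.fst_add, Prod.snd_add, h3, h4]
    exact A.graph.add_mem h1 h2
  smul_mem' := by
    intro c p hp n
    filter_upwards [hp n, comp_smul c p.1 n, comp_smul c p.2 n] with k h1 h3 h4
    simp only [Prod.smul_fst, Prod.smul_snd, h3, h4]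
    exact A.graph.smul_mem c h1

theorem tensorIdGraph_single_valued (A : H →ₗ.[ℂ] H) (p : Fock d H × Fock d H)
    (hp : p ∈ tensorIdGraph A) (h0 : p.1 = 0) : p.2 = 0 := by
  refine ext_comp fun n => ?_
  filter_upwards [hp n, comp_zero (d := d) (H := H) n] with k h1 h2
  rw [h0, h2] at h1
  rw [h2]
  exact A.graph_fst_eq_zero_snd h1 rfl

/-- The operator `A ⊗ I` with its natural maximal domain. -/
def tensorId (A : H →ₗ.[ℂ] H) : Fock d H →ₗ.[ℂ] Fock d H := (tensorIdGraph A).toLinearPMap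

theorem tensorId_graph (A : H →ₗ.[ℂ] H) :
    (tensorId A : Fock d H →ₗ.[ℂ] Fock d H).graph = tensorIdGraph A :=
  Submodule.toLinearPMap_graph_eq _ (tensorIdGraph_single_valued A)

/-- The graph of the multiplication operator by the functions `g n` of `n` momenta. -/
def mulGraph (g : ∀ n : ℕ, (Fin n → Mom d) → ℝ) : Submodule ℂ (Fock d H × Fock d H) where
  carrier := {p | ∀ n, ∀ᵐ k, comp p.2 n k = (g n k : ℂ) • comp p.1 n k}
  zero_mem' := by
    intro n
    filter_upwards [comp_zero (d := d) (H := H) n] with k h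
    simp [h]
  add_mem' := by
    intro p q hp hq n
    filter_upwards [hp n, hq n, comp_add p.1 q.1 n, comp_add p.2 q.2 n] with k h1 h2 h3 h4
    simp only [Prod.fst_add, Prod.snd_add, h3, h4, Pi.add_apply, h1, h2, smul_add]
  smul_mem' := by
    intro c p hp n
    filter_upwards [hp n, comp_smul c p.1 n, comp_smul c p.2 n] with k h1 h3 h4
    simp only [Prod.smul_fst, Prod.smul_snd, h3, h4, Pi.smul_apply, h1]
    rw [smul_comm]

theorem mulGraph_single_valued (g : ∀ n : ℕ, (Fin n → Mom d) → ℝ) (p : Fock d H × Fock d H)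
    (hp : p ∈ mulGraph g) (h0 : p.1 = 0) : p.2 = 0 := by
  refine ext_comp fun n => ?_
  filter_upwards [hp n, comp_zero (d := d) (H := H) n] with k h1 h2
  rw [h0, h2] at h1
  rw [h2, h1]
  simp

/-- The maximal multiplication operator by the functions `g n` of `n` momenta. -/
def mulOp (g : ∀ n : ℕ, (Fin n → Mom d) → ℝ) : Fock d H →ₗ.[ℂ] Fock d H :=
  (mulGraph g).toLinearPMap

theorem mulOp_graph (g : ∀ n : ℕ, (Fin n → Mom d) → ℝ) :
    (mulOp g : Fock d H →ₗ.[ℂ] Fock d H).graph = mulGraph g :=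
  Submodule.toLinearPMap_graph_eq _ (mulGraph_single_valued g)

/-- `I ⊗ dΓ(h)`, the second quantization of multiplication by the real function `h`: on the
`n`-boson sector it is multiplication by `h(k₁) + ⋯ + h(kₙ)`. -/
def dGamma (h : Mom d → ℝ) : Fock d H →ₗ.[ℂ] Fock d H := mulOp fun _ k => ∑ j, h (k j)

/-- The square root of `I ⊗ dΓ(h)` for `h ≥ 0`. -/
def sqrtDGamma (h : Mom d → ℝ) : Fock d H →ₗ.[ℂ] Fock d H :=
  mulOp fun _ k => Real.sqrt (∑ j, h (k j))

variable (d H) in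
/-- The boson number operator `N = I ⊗ dΓ(1)`. -/
def numberOp : Fock d H →ₗ.[ℂ] Fock d H := dGamma fun _ => 1

variable (d H) in
/-- The square root `N^{1/2}` of the number operator. -/
def sqrtNumberOp : Fock d H →ₗ.[ℂ] Fock d H := sqrtDGamma fun _ => 1

/-- The free Hamiltonian `H₀ = A ⊗ I + I ⊗ dΓ(ω)`, on the intersection of the two domains. -/
def freeHamiltonian (A : H →ₗ.[ℂ] H) (ω : Mom d → ℝ) : Fock d H →ₗ.[ℂ] Fock d H :=
  tensorId A + dGamma ω

theorem ae_memLp_slice (Ψ : Fock d H) (n : ℕ) : ∀ᵐ k : Fin n → Mom d,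
    MemLp (fun q : Mom d => comp Ψ (n + 1) (Fin.cons q k)) 2 volume := by
  have hmp := (volume_preserving_piFinSuccAbove (fun _ : Fin (n + 1) => Mom d) 0).symm
  have h1 := (memLp_comp Ψ (n + 1)).comp_measurePreserving hmp
  have h2 : MemLp (fun p : (Fin n → Mom d) × Mom d =>
      comp Ψ (n + 1) (Fin.cons p.2 p.1)) 2 (volume.prod volume) := by
    have h3 := h1.comp_measurePreserving
      (Measure.measurePreserving_swap (μ := (volume : Measure (Fin n → Mom d)))
        (ν := (volume : Measure (Mom d))))
    refine h3.ae_eq (Eventually.of_forall fun p => ?_)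
    simp [MeasurableEquiv.piFinSuccAbove_symm_apply, Fin.insertNthEquiv]
  have h4 := h2.1.prodMk_left
  have h5 := ((memLp_two_iff_integrable_sq_norm h2.1).1 h2).prod_right_ae
  filter_upwards [h4, h5] with k h6 h7
  exact (memLp_two_iff_integrable_sq_norm h6).2 h7

theorem ae_integrable_slice (f : Lp ℂ 2 (volume : Measure (Mom d)))
    (Ψ : Fock d H) (n : ℕ) : ∀ᵐ k : Fin n → Mom d,
      Integrable (fun q : Mom d => conj (f q) • comp Ψ (n + 1) (Fin.cons q k)) volume := by
  filter_upwards [ae_memLp_slice Ψ n] with k hk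
  have hf : MemLp (fun q => conj (f q)) 2 volume := (Lp.memLp f).star
  exact memLp_one_iff_integrable.1 (hk.smul (r := 1) hf)

theorem ae_slice {n : ℕ} {p : (Fin (n + 1) → Mom d) → Prop} (h : ∀ᵐ k, p k) :
    ∀ᵐ k : Fin n → Mom d, ∀ᵐ q : Mom d, p (Fin.cons q k) := by
  have hmp := (volume_preserving_piFinSuccAbove (fun _ : Fin (n + 1) => Mom d) 0).symm
  have h1 := hmp.quasiMeasurePreserving.ae h
  have h2 := (Measure.measurePreserving_swap (μ := (volume : Measure (Fin n → Mom d)))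
        (ν := (volume : Measure (Mom d)))).quasiMeasurePreserving.ae h1
  have h3 := Measure.ae_ae_of_ae_prod h2
  filter_upwards [h3] with k hk
  filter_upwards [hk] with q hq
  simpa [MeasurableEquiv.piFinSuccAbove_symm_apply, Fin.insertNthEquiv, Fin.insertNth_zero]
    using hq

/-- The graph of the annihilation operator `a(f) = I ⊗ a_b(f)`,
`(a(f) Ψ)⁽ⁿ⁾(k₁, …, kₙ) = √(n+1) ∫ conj (f q) Ψ⁽ⁿ⁺¹⁾(q, k₁, …, kₙ) dq`. -/
def annihilationGraph (f : Lp ℂ 2 (volume : Measure (Mom d))) :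
    Submodule ℂ (Fock d H × Fock d H) where
  carrier := {p | ∀ n, ∀ᵐ k, comp p.2 n k =
    (Real.sqrt (n + 1) : ℂ) • ∫ q : Mom d, conj (f q) • comp p.1 (n + 1) (Fin.cons q k)}
  zero_mem' := by
    intro n
    filter_upwards [comp_zero (d := d) (H := H) n,
      ae_slice (comp_zero (d := d) (H := H) (n + 1))] with k h1 h2
    have : (fun q : Mom d => conj (f q) • comp (0 : Fock d H) (n + 1) (Fin.cons q k))
        =ᵐ[volume] 0 := by
      filter_upwards [h2] with q hq
      simp [hq]
    simp only [Prod.fst_zero, Prod.snd_zero, h1]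
    rw [integral_congr_ae this]
    simp
  add_mem' := by
    intro p p' hp hp' n
    filter_upwards [hp n, hp' n, comp_add p.2 p'.2 n, ae_slice (comp_add p.1 p'.1 (n + 1)),
      ae_integrable_slice f p.1 n, ae_integrable_slice f p'.1 n] with k h1 h2 h3 h4 h5 h6
    have : (fun q : Mom d => conj (f q) • comp (p.1 + p'.1) (n + 1) (Fin.cons q k))
        =ᵐ[volume] fun q => conj (f q) • comp p.1 (n + 1) (Fin.cons q k) +
          conj (f q) • comp p'.1 (n + 1) (Fin.cons q k) := by
      filter_upwards [h4] with q hq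
      rw [hq, Pi.add_apply, smul_add]
    simp only [Prod.fst_add, Prod.snd_add, h3, Pi.add_apply]
    rw [integral_congr_ae this, integral_add h5 h6, h1, h2, smul_add]
  smul_mem' := by
    intro c p hp n
    filter_upwards [hp n, comp_smul c p.2 n, ae_slice (comp_smul c p.1 (n + 1))] with k h1 h3 h4
    have : (fun q : Mom d => conj (f q) • comp (c • p.1) (n + 1) (Fin.cons q k))
        =ᵐ[volume] fun q => c • (conj (f q) • comp p.1 (n + 1) (Fin.cons q k)) := by
      filter_upwards [h4] with q hq
      rw [hq, Pi.smul_apply, smul_comm]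
    simp only [Prod.smul_fst, Prod.smul_snd, h3, Pi.smul_apply]
    rw [integral_congr_ae this, integral_smul, h1, smul_comm]

theorem annihilationGraph_single_valued (f : Lp ℂ 2 (volume : Measure (Mom d)))
    (p : Fock d H × Fock d H) (hp : p ∈ annihilationGraph f) (h0 : p.1 = 0) : p.2 = 0 := by
  refine ext_comp fun n => ?_
  filter_upwards [hp n, (annihilationGraph (d := d) (H := H) f).zero_mem n] with k h1 h2
  rw [h0] at h1
  simp only [Prod.fst_zero, Prod.snd_zero] at h2
  rw [h1, h2]

/-- The annihilation operator `a(f) = I ⊗ a_b(f)`, on its maximal domain. -/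
def annihilation (f : Lp ℂ 2 (volume : Measure (Mom d))) : Fock d H →ₗ.[ℂ] Fock d H :=
  (annihilationGraph f).toLinearPMap

theorem annihilation_graph (f : Lp ℂ 2 (volume : Measure (Mom d))) :
    (annihilation f : Fock d H →ₗ.[ℂ] Fock d H).graph = annihilationGraph f :=
  Submodule.toLinearPMap_graph_eq _ (annihilationGraph_single_valued f)

end FockSpace

/-! ### The pull-through kernel and the maximal Carleman operator -/

section PullThrough

variable {d : ℕ} {F : Type*} [NormedAddCommGroup F] [InnerProductSpace ℂ F]

/-- The operator `(S - inf σ(S) + ω(k))⁻¹ B(k)`, on the domain of `B(k)`. -/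
def pullThroughOp (S : F →ₗ.[ℂ] F) (w : Mom d → ℝ) (B : Mom d → F →ₗ.[ℂ] F) (k : Mom d) :
    F →ₗ.[ℂ] F :=
  LinearMap.compPMap (resolventAt S ((groundEnergy S - w k : ℝ) : ℂ) : F →ₗ[ℂ] F) (B k)

/-- The kernel `K(k) = (S - inf σ(S) + ω(k))⁻¹ B(k) Ψ`. Only its values at `k ≠ 0` matter. -/
def pullThroughKernel (S : F →ₗ.[ℂ] F) (w : Mom d → ℝ) (B : Mom d → F →ₗ.[ℂ] F) (Ψ : F)
    (k : Mom d) : F :=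
  applyPMap (pullThroughOp S w B k) Ψ

/-- `M_ε = (∫_{|k| > ε} ‖(S - inf σ(S) + ω(k))⁻¹ B(k)‖² dk)^{1/2}`, with values in `[0, ∞]`. -/
def pullThroughBound (S : F →ₗ.[ℂ] F) (w : Mom d → ℝ) (B : Mom d → F →ₗ.[ℂ] F) (ε : ℝ) : ℝ≥0∞ :=
  (∫⁻ k in {k : Mom d | ε < ‖k‖}, opENorm (pullThroughOp S w B k) ^ 2) ^ (1 / 2 : ℝ)

/-- The maximal Carleman operator `(T Φ)(k) = (K(k), Φ)` from `F` to `L²(ℝ^d)` induced by `K`, with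
domain all `Φ` for which `(K(·), Φ)` is square integrable. -/
def carleman (K : Mom d → F) : F →ₗ.[ℂ] Lp ℂ 2 (volume : Measure (Mom d)) where
  domain :=
    { carrier := {Φ | MemLp (fun k => inner ℂ (K k) Φ) 2 volume}
      zero_mem' := by simp
      add_mem' := by
        intro Φ Φ' h h'
        simpa only [Set.mem_ofPred_eq, inner_add_right] using! h.add h'
      smul_mem' := by
        intro c Φ h
        simpa only [Set.mem_ofPred_eq, inner_smul_right] using! h.const_mul c }
  toFun :=
    { toFun := fun Φ => MemLp.toLp (fun k => inner ℂ (K k) (Φ : F)) Φ.2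
      map_add' := by
        intro Φ Φ'
        rw [← MemLp.toLp_add]
        congr 1
        funext k
        simp
      map_smul' := by
        intro c Φ
        rw [RingHom.id_apply, ← MemLp.toLp_const_smul]
        congr 1
        funext k
        simp }

end PullThrough

end

end QFT

open QFT

/-!
Write `K(k) = (Ĥ + ω(k))⁻¹ B(k) Ψ`. Tested against smooth functions supported away from `0`, the
pull-through formula says that `-K(q)` is the distribution `a(q) Ψ`, that is
`K(q)⁽ⁿ⁾ = -√(n+1) Ψ⁽ⁿ⁺¹⁾(q, ·)` for almost every `q`. Summing the squared norms over `n` and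
integrating over `q` gives `∫ ‖K‖² = ∑ n ‖Ψ⁽ⁿ⁾‖²`, which is finite exactly when `Ψ ∈ D(N^{1/2})`;
by Parseval's identity the same integral is the squared Hilbert-Schmidt norm of the Carleman
operator. Finally `‖K(k)‖ ≤ ‖(Ĥ + ω(k))⁻¹ B(k)‖`, so the integral of `‖K‖²` over `|k| > ε` is at
most `M_ε²`, and `ε ↓ 0` yields `‖T‖ ≤ (∫ ‖K‖²)^{1/2} ≤ M₀`.
-/

namespace QFT

/-! ### Resolvents -/

section Resolvent

variable {F : Type*} [NormedAddCommGroup F] [InnerProductSpace ℂ F]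

theorem IsResolventAt.sub_eq {S : F →ₗ.[ℂ] F} {z z' : ℂ} {R R' : F →L[ℂ] F}
    (h : IsResolventAt S z R) (h' : IsResolventAt S z' R') :
    R - R' = (z - z') • R.comp R' := by
  ext y
  obtain ⟨hy, hSy⟩ := h'.1 y
  have hR : R (S ⟨R' y, hy⟩ - z • R' y) = R' y := h.2 ⟨R' y, hy⟩
  have hshift : S ⟨R' y, hy⟩ - z • R' y = y - (z - z') • R' y := by
    rw [sub_eq_iff_eq_add.1 hSy, sub_smul]
    abel
  rw [hshift, map_sub, map_smul, sub_eq_iff_eq_add'] at hR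
  simp only [sub_apply, smul_apply, ContinuousLinearMap.comp_apply]
  rw [hR]
  abel

theorem IsResolventAt.norm_sub_le {S : F →ₗ.[ℂ] F} {z z' : ℂ} {R R' : F →L[ℂ] F}
    (h : IsResolventAt S z R) (h' : IsResolventAt S z' R') (hz : ‖z' - z‖ * ‖R‖ ≤ 1 / 2) :
    ‖R' - R‖ ≤ 2 * ‖z' - z‖ * ‖R‖ ^ 2 := by
  have hsub : ‖R' - R‖ ≤ ‖z' - z‖ * (‖R'‖ * ‖R‖) := by
    rw [h'.sub_eq h, norm_smul]
    gcongr
    exact ContinuousLinearMap.opNorm_comp_le _ _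
  have hR' : ‖R'‖ ≤ 2 * ‖R‖ := by
    have htri : ‖R'‖ ≤ ‖R‖ + ‖R' - R‖ := norm_le_insert' R' R
    nlinarith [norm_nonneg R']
  calc ‖R' - R‖ ≤ ‖z' - z‖ * (‖R'‖ * ‖R‖) := hsub
    _ ≤ ‖z' - z‖ * (2 * ‖R‖ * ‖R‖) := by gcongr
    _ = 2 * ‖z' - z‖ * ‖R‖ ^ 2 := by ring

theorem isResolventAt_resolventAt {S : F →ₗ.[ℂ] F} {z : ℂ} (h : z ∉ pmapSpectrum S) :
    IsResolventAt S z (resolventAt S z) := by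
  have hex : ∃ R : F →L[ℂ] F, IsResolventAt S z R := not_not.1 h
  rw [resolventAt, dif_pos hex]
  exact hex.choose_spec

theorem continuousOn_resolventAt (S : F →ₗ.[ℂ] F) :
    ContinuousOn (resolventAt S) (pmapSpectrum S)ᶜ := by
  intro z hz
  have hdist : Tendsto (fun z' => ‖z' - z‖) (𝓝[(pmapSpectrum S)ᶜ] z) (𝓝 0) :=
    tendsto_iff_norm_sub_tendsto_zero.1 (continuousWithinAt_id.tendsto)
  have hsmall : ∀ᶠ z' in 𝓝[(pmapSpectrum S)ᶜ] z, ‖z' - z‖ * ‖resolventAt S z‖ < 1 / 2 := by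
    have hlim := hdist.mul_const ‖resolventAt S z‖
    rw [zero_mul] at hlim
    exact hlim.eventually_lt_const (by norm_num)
  have hbound : Tendsto (fun z' => 2 * ‖z' - z‖ * ‖resolventAt S z‖ ^ 2)
      (𝓝[(pmapSpectrum S)ᶜ] z) (𝓝 0) := by
    simpa using (hdist.const_mul 2).mul_const (‖resolventAt S z‖ ^ 2)
  refine tendsto_iff_norm_sub_tendsto_zero.2
    (squeeze_zero' (Eventually.of_forall fun _ => norm_nonneg _) ?_ hbound)
  filter_upwards [hsmall, self_mem_nhdsWithin] with z' hz' hmem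
  exact (isResolventAt_resolventAt hz).norm_sub_le (isResolventAt_resolventAt hmem) hz'.le

theorem notMem_pmapSpectrum_of_lt_groundEnergy {S : F →ₗ.[ℂ] F} (hS : BddBelow (realSpectrum S))
    {x : ℝ} (hx : x < groundEnergy S) : (x : ℂ) ∉ pmapSpectrum S := fun hmem =>
  hx.not_ge (csInf_le hS hmem)

theorem continuousOn_resolventAt_Iio_groundEnergy {S : F →ₗ.[ℂ] F}
    (hS : BddBelow (realSpectrum S)) :
    ContinuousOn (fun x : ℝ => resolventAt S x) (Set.Iio (groundEnergy S)) :=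
  (continuousOn_resolventAt S).comp Complex.continuous_ofReal.continuousOn fun _ hx =>
    notMem_pmapSpectrum_of_lt_groundEnergy hS hx

theorem aestronglyMeasurable_resolventAt_groundEnergy_sub {X : Type*} [MeasurableSpace X]
    {μ : Measure X} {S : F →ₗ.[ℂ] F} (hS : BddBelow (realSpectrum S)) {w : X → ℝ}
    (hw : AEMeasurable w μ) (hpos : ∀ᵐ x ∂μ, 0 < w x) :
    AEStronglyMeasurable (fun x => resolventAt S ((groundEnergy S - w x : ℝ) : ℂ)) μ := by
  have hu : AEMeasurable (fun x => groundEnergy S - w x) μ := hw.const_sub _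
  have hmem : ∀ᵐ t ∂μ.map (fun x => groundEnergy S - w x), t ∈ Set.Iio (groundEnergy S) := by
    refine (ae_map_iff hu measurableSet_Iio).2 ?_
    filter_upwards [hpos] with x hx using sub_lt_self _ hx
  have hR : AEStronglyMeasurable (fun t : ℝ => resolventAt S t)
      (μ.map fun x => groundEnergy S - w x) := by
    rw [← Measure.restrict_eq_self_of_ae_mem hmem]
    exact (continuousOn_resolventAt_Iio_groundEnergy hS).aestronglyMeasurable measurableSet_Iio
  exact hR.comp_aemeasurable hu

end Resolvent

/-! ### Square summability and separability -/

section Hilbert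

theorem summable_norm_sq_iff_tsum_enorm_sq_lt_top {ι : Type*} {E : ι → Type*}
    [∀ i, NormedAddCommGroup (E i)] {f : ∀ i, E i} :
    (Summable fun i => ‖f i‖ ^ 2) ↔ ∑' i, ‖f i‖ₑ ^ 2 < ⊤ := by
  have h := tsum_enorm_ne_top_iff_summable_norm (f := fun i => ‖f i‖ ^ 2)
  simpa only [enorm_pow, enorm_norm, norm_pow, norm_norm, ← lt_top_iff_ne_top] using h.symm

theorem memℓp_two_iff_tsum_enorm_sq_lt_top {ι : Type*} {E : ι → Type*}
    [∀ i, NormedAddCommGroup (E i)] {f : ∀ i, E i} :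
    Memℓp f 2 ↔ ∑' i, ‖f i‖ₑ ^ 2 < ⊤ := by
  rw [memℓp_gen_iff (by norm_num), ← summable_norm_sq_iff_tsum_enorm_sq_lt_top]
  simp only [ENNReal.toReal_ofNat, Real.rpow_ofNat]

theorem enorm_sq_eq_tsum_lp {ι : Type*} {E : ι → Type*} [∀ i, NormedAddCommGroup (E i)]
    (f : lp E 2) : ‖f‖ₑ ^ 2 = ∑' i, ‖f i‖ₑ ^ 2 := by
  have hsum := lp.hasSum_norm (p := 2) (by norm_num) f
  simp only [ENNReal.toReal_ofNat, Real.rpow_ofNat] at hsum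
  have htsum := ENNReal.ofReal_tsum_of_nonneg (fun i => by positivity) hsum.summable
  rw [hsum.tsum_eq] at htsum
  simpa [ENNReal.ofReal_pow, ofReal_norm] using htsum

variable {𝕜 F : Type*} [RCLike 𝕜] [NormedAddCommGroup F] [InnerProductSpace 𝕜 F]

theorem enorm_sq_eq_tsum_enorm_inner_sq {ι : Type*} (b : HilbertBasis ι 𝕜 F) (x : F) :
    ‖x‖ₑ ^ 2 = ∑' i, ‖inner 𝕜 x (b i)‖ₑ ^ 2 := by
  have hrepr : ∀ i, ‖inner 𝕜 x (b i)‖ₑ = ‖b.repr x i‖ₑ := fun i => by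
    rw [b.repr_apply_apply, ← ofReal_norm, ← ofReal_norm, norm_inner_symm]
  simp only [hrepr, ← enorm_sq_eq_tsum_lp]
  rw [← ofReal_norm, ← ofReal_norm, b.repr.norm_map]

theorem countable_of_orthonormal [TopologicalSpace.SeparableSpace F] {ι : Type*} {v : ι → F}
    (hv : Orthonormal 𝕜 v) : Countable ι := by
  have hdisj : Pairwise (Function.onFun Disjoint fun i => Metric.ball (v i) (1 / 2 : ℝ)) := by
    intro i j hij
    refine Metric.ball_disjoint_ball ?_
    have hsq := norm_sub_sq (𝕜 := 𝕜) (v i) (v j)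
    rw [hv.2 hij, hv.1 i, hv.1 j, map_zero] at hsq
    rw [dist_eq_norm]
    nlinarith [norm_nonneg (v i - v j)]
  exact hdisj.countable_of_isOpen_disjoint (fun _ => Metric.isOpen_ball)
    fun i => ⟨v i, Metric.mem_ball_self (by norm_num)⟩

theorem aestronglyMeasurable_of_forall_inner [CompleteSpace F]
    [TopologicalSpace.SeparableSpace F] {X : Type*} [MeasurableSpace X] {μ : Measure X}
    {f : X → F} (h : ∀ y : F, AEStronglyMeasurable (fun x => inner 𝕜 y (f x)) μ) :
    AEStronglyMeasurable f μ := by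
  obtain ⟨w, b, -⟩ := exists_hilbertBasis 𝕜 F
  have : Countable w := countable_of_orthonormal b.orthonormal
  refine aestronglyMeasurable_of_tendsto_ae (u := atTop)
    (f := fun (s : Finset w) x => ∑ i ∈ s, b.repr (f x) i • b i) (fun s => ?_)
    (Eventually.of_forall fun x => b.hasSum_repr (f x))
  refine Finset.aestronglyMeasurable_fun_sum s fun i _ => ?_
  simp only [b.repr_apply_apply]
  exact (h (b i)).smul_const _

end Hilbert

/-! ### Lebesgue spaces -/

section Lebesgue

variable {X : Type*} [MeasurableSpace X] {μ : Measure X} {E : Type*} [NormedAddCommGroup E]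

theorem eLpNorm_two_sq (f : X → E) : eLpNorm f 2 μ ^ 2 = ∫⁻ x, ‖f x‖ₑ ^ 2 ∂μ := by
  simpa using eLpNorm_nnreal_pow_eq_lintegral (f := f) (μ := μ) (p := 2) two_ne_zero

theorem memLp_two_iff_eLpNorm_sq_lt_top {f : X → E} (hf : AEStronglyMeasurable f μ) :
    MemLp f 2 μ ↔ eLpNorm f 2 μ ^ 2 < ⊤ := by
  simp [MemLp, hf, ENNReal.pow_lt_top_iff]

theorem tendsto_eLpNorm_restrict_of_aecover {ι : Type*} {l : Filter ι} [l.IsCountablyGenerated]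
    {φ : ι → Set X} (hφ : AECover μ l φ) {f : X → E} (hf : AEStronglyMeasurable f μ) {p : ℝ≥0∞}
    (hp0 : p ≠ 0) (hp : p ≠ ⊤) :
    Tendsto (fun i => eLpNorm f p (μ.restrict (φ i))) l (𝓝 (eLpNorm f p μ)) := by
  simp only [eLpNorm_eq_lintegral_rpow_enorm_toReal hp0 hp]
  exact (hφ.lintegral_tendsto_of_countably_generated (hf.enorm.pow_const _)).ennrpow_const _

theorem eLpNorm_inner_le {𝕜 F : Type*} [RCLike 𝕜] [NormedAddCommGroup F] [InnerProductSpace 𝕜 F]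
    (f : X → F) (y : F) (p : ℝ≥0∞) :
    eLpNorm (fun x => inner 𝕜 (f x) y) p μ ≤ eLpNorm f p μ * ‖y‖ₑ := by
  have hle : ∀ x, ‖inner 𝕜 (f x) y‖₊ ≤ ‖y‖₊ * ‖f x‖₊ := fun x =>
    (nnnorm_inner_le_nnnorm (f x) y).trans_eq (mul_comm _ _)
  have h := eLpNorm_le_nnreal_smul_eLpNorm_of_ae_le_mul (ae_of_all μ hle) p
  rwa [ENNReal.smul_def, smul_eq_mul, mul_comm] at h

theorem aecover_lt_norm [MeasurableSpace E] [OpensMeasurableSpace E] (ν : Measure E)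
    [NullSingletonClass ν] : AECover ν (𝓝[>] (0 : ℝ)) fun ε => {x : E | ε < ‖x‖} where
  ae_eventually_mem := by
    filter_upwards [Measure.ae_ne ν 0] with x hx
    exact nhdsWithin_le_nhds (Iio_mem_nhds (norm_pos_iff.2 hx))
  measurableSet _ := measurableSet_lt measurable_const measurable_norm

theorem locallyIntegrableOn_compl_zero_of_memLp_restrict {V : Type*} [NormedAddCommGroup V]
    [MeasurableSpace V] [OpensMeasurableSpace V] {ν : Measure V} [IsLocallyFiniteMeasure ν]
    {p : ℝ≥0∞} (hp : 1 ≤ p) {f : V → E}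
    (h : ∀ ε : ℝ, 0 < ε → MemLp f p (ν.restrict {x | ε < ‖x‖})) :
    LocallyIntegrableOn f {0}ᶜ ν := by
  intro x hx
  have hx0 : 0 < ‖x‖ := norm_pos_iff.2 hx
  obtain ⟨t, ht, hint⟩ := (h (‖x‖ / 2) (half_pos hx0)).locallyIntegrable hp x
  have hopen : IsOpen {y : V | ‖x‖ / 2 < ‖y‖} := isOpen_lt continuous_const continuous_norm
  refine ⟨t ∩ {y | ‖x‖ / 2 < ‖y‖}, mem_nhdsWithin_of_mem_nhds
    (inter_mem ht (hopen.mem_nhds (half_lt_self hx0))), ?_⟩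
  rwa [IntegrableOn, ← Measure.restrict_restrict' hopen.measurableSet]

theorem integrable_smul_of_tsupport_subset {V : Type*} [TopologicalSpace V] [T2Space V]
    [MeasurableSpace V] [OpensMeasurableSpace V] {ν : Measure V} [NormedSpace ℝ E] {U : Set V}
    {f : V → E} (hf : LocallyIntegrableOn f U ν) {g : V → ℝ} (hg : Continuous g)
    (hgc : HasCompactSupport g) (hgU : tsupport g ⊆ U) : Integrable (fun x => g x • f x) ν := by
  have hint : IntegrableOn (fun x => g x • f x) (tsupport g) ν :=
    (hf.integrableOn_compact_subset hgU hgc).continuousOn_smul hg.continuousOn hgc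
  exact (integrableOn_iff_integrable_of_support_subset
    ((Function.support_smul_subset_left g f).trans (subset_tsupport g))).1 hint

end Lebesgue

/-! ### Slices of square integrable functions of two variables -/

section Slice

variable {X Y : Type*} [MeasurableSpace X] [MeasurableSpace Y] {μ : Measure X} {ν : Measure Y}
  {𝕜 E : Type*} [RCLike 𝕜] [NormedAddCommGroup E]

theorem ae_memLp_two_prodMk_left [SFinite ν] {u : X × Y → E} (hu : MemLp u 2 (μ.prod ν)) :
    ∀ᵐ x ∂μ, MemLp (fun y => u (x, y)) 2 ν := by
  have hsq : Integrable (fun p => ‖u p‖ ^ 2) (μ.prod ν) :=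
    (memLp_two_iff_integrable_sq_norm hu.1).1 hu
  filter_upwards [hu.1.prodMk_left, ((integrable_prod_iff hsq.1).1 hsq).1] with x hmeas hint
  exact (memLp_two_iff_integrable_sq_norm hmeas).2 hint

open Classical in
/-- The slice `u (x, ·)` of a function of two variables as an element of `L²`, which turns square
integrable functions on `X × Y` into `L²`-valued functions on `X`. It is the dummy `0` at the points
`x` where the slice is not square integrable. -/
noncomputable def sliceLp (ν : Measure Y) (u : X × Y → E) (x : X) : Lp E 2 ν :=
  if h : MemLp (fun y => u (x, y)) 2 ν then h.toLp _ else 0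

theorem coeFn_sliceLp {X : Type*} {u : X × Y → E} {x : X} (h : MemLp (fun y => u (x, y)) 2 ν) :
    sliceLp ν u x =ᵐ[ν] fun y => u (x, y) := by
  rw [sliceLp, dif_pos h]
  exact h.coeFn_toLp

theorem eLpNorm_sliceLp [SFinite ν] {u : X × Y → E} (hu : MemLp u 2 (μ.prod ν)) :
    eLpNorm (sliceLp ν u) 2 μ = eLpNorm u 2 (μ.prod ν) := by
  refine (ENNReal.pow_right_strictMono two_ne_zero).injective ?_
  simp only [eLpNorm_two_sq]
  rw [lintegral_prod _ (hu.1.enorm.pow_const 2)]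
  refine lintegral_congr_ae ?_
  filter_upwards [ae_memLp_two_prodMk_left hu] with x hx
  rw [sliceLp, dif_pos hx, Lp.enorm_toLp, eLpNorm_two_sq]

theorem memLp_two_smul_prod [NormedSpace 𝕜 E] [SFinite ν] {g : X → 𝕜} (hg : MemLp g 2 μ)
    {φ : Y → E} (hφ : MemLp φ 2 ν) : MemLp (fun p : X × Y => g p.1 • φ p.2) 2 (μ.prod ν) := by
  have hmeas : AEStronglyMeasurable (fun p : X × Y => g p.1 • φ p.2) (μ.prod ν) :=
    hg.1.comp_fst.smul hφ.1.comp_snd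
  have hnorm : eLpNorm (fun p : X × Y => g p.1 • φ p.2) 2 (μ.prod ν) ^ 2 =
      eLpNorm g 2 μ ^ 2 * eLpNorm φ 2 ν ^ 2 := by
    simp only [eLpNorm_two_sq, enorm_smul, mul_pow]
    exact lintegral_prod_mul (hg.1.enorm.pow_const 2) (hφ.1.enorm.pow_const 2)
  rw [memLp_two_iff_eLpNorm_sq_lt_top hmeas, hnorm]
  exact ENNReal.mul_lt_top (ENNReal.pow_lt_top hg.2) (ENNReal.pow_lt_top hφ.2)

variable [InnerProductSpace 𝕜 E]

theorem inner_sliceLp {X : Type*} {u : X × Y → E} {x : X} (h : MemLp (fun y => u (x, y)) 2 ν)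
    (φ : Lp E 2 ν) : inner 𝕜 φ (sliceLp ν u x) = ∫ y, inner 𝕜 (φ y) (u (x, y)) ∂ν := by
  rw [L2.inner_def]
  refine integral_congr_ae ?_
  filter_upwards [coeFn_sliceLp h] with y hy
  rw [hy]

theorem memLp_sliceLp (𝕜 : Type*) {E : Type*} [RCLike 𝕜] [NormedAddCommGroup E]
    [InnerProductSpace 𝕜 E] [CompleteSpace E] [TopologicalSpace.SeparableSpace (Lp E 2 ν)]
    [SFinite ν] {u : X × Y → E} (hu : MemLp u 2 (μ.prod ν)) :
    MemLp (sliceLp ν u) 2 μ := by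
  refine ⟨aestronglyMeasurable_of_forall_inner (𝕜 := 𝕜) fun φ => ?_, ?_⟩
  · have hprod : AEStronglyMeasurable (fun p : X × Y => inner 𝕜 (φ p.2) (u p)) (μ.prod ν) :=
      (Lp.memLp φ).1.comp_snd.inner hu.1
    refine hprod.integral_prod_right'.congr ?_
    filter_upwards [ae_memLp_two_prodMk_left hu] with x hx
    rw [inner_sliceLp hx]
  · rw [eLpNorm_sliceLp hu]
    exact hu.2

theorem integrable_mul_inner_prod [SFinite ν] {g : X → 𝕜} (hg : MemLp g 2 μ) {φ : Y → E}
    (hφ : MemLp φ 2 ν) {u : X × Y → E} (hu : MemLp u 2 (μ.prod ν)) :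
    Integrable (fun p : X × Y => g p.1 * inner 𝕜 (φ p.2) (u p)) (μ.prod ν) := by
  have hgφ := memLp_two_smul_prod hg.star hφ
  refine (L2.integrable_inner (𝕜 := 𝕜) (hgφ.toLp _) (hu.toLp _)).congr ?_
  filter_upwards [hgφ.coeFn_toLp, hu.coeFn_toLp] with p hleft hright
  rw [hleft, hright, inner_smul_left, Pi.star_apply, RCLike.star_def, RCLike.conj_conj]

theorem eq_integral_smul_sliceLp [CompleteSpace E] [NormedSpace ℝ E]
    [TopologicalSpace.SeparableSpace (Lp E 2 ν)]
    [SFinite μ] [SFinite ν] {u : X × Y → E} (hu : MemLp u 2 (μ.prod ν)) {g : X → 𝕜}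
    (hg : MemLp g 2 μ) {v : Lp E 2 ν} (hv : v =ᵐ[ν] fun y => ∫ x, g x • u (x, y) ∂μ) :
    v = ∫ x, g x • sliceLp ν u x ∂μ := by
  have hslice : Integrable (fun x => g x • sliceLp ν u x) μ :=
    memLp_one_iff_integrable.1 ((memLp_sliceLp 𝕜 hu).smul (r := 1) hg)
  have hswap : MemLp (fun p : Y × X => u (p.2, p.1)) 2 (ν.prod μ) :=
    hu.comp_measurePreserving Measure.measurePreserving_swap
  refine ext_inner_left 𝕜 fun φ => ?_
  calc inner 𝕜 φ v = ∫ y, ∫ x, g x * inner 𝕜 (φ y) (u (x, y)) ∂μ ∂ν := by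
        rw [L2.inner_def]
        refine integral_congr_ae ?_
        filter_upwards [hv, ae_memLp_two_prodMk_left hswap] with y hvy huy
        have hint : Integrable (fun x => g x • u (x, y)) μ :=
          memLp_one_iff_integrable.1 (huy.smul (r := 1) hg)
        rw [hvy, ← integral_inner hint]
        simp only [inner_smul_right]
    _ = ∫ x, ∫ y, g x * inner 𝕜 (φ y) (u (x, y)) ∂ν ∂μ :=
        (integral_integral_swap (integrable_mul_inner_prod hg (Lp.memLp φ) hu)).symm
    _ = ∫ x, inner 𝕜 φ (g x • sliceLp ν u x) ∂μ := by
        refine integral_congr_ae ?_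
        filter_upwards [ae_memLp_two_prodMk_left hu] with x hx
        rw [inner_smul_right, inner_sliceLp hx, integral_const_mul]
    _ = inner 𝕜 φ (∫ x, g x • sliceLp ν u x ∂μ) := integral_inner hslice φ

end Slice

/-! ### Components of Fock space vectors -/

section Fock

instance fact_two_ne_top : Fact ((2 : ℝ≥0∞) ≠ ⊤) := ⟨ENNReal.ofNat_ne_top⟩

variable {d : ℕ} {H : Type*} [NormedAddCommGroup H] [InnerProductSpace ℂ H]

instance separableSpace_fock [TopologicalSpace.SeparableSpace H] :
    TopologicalSpace.SeparableSpace (Fock d H) := by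
  have hsep : TopologicalSpace.IsSeparable
      (⋃ n : ℕ, Set.range (lp.singleContinuousLinearMap ℂ (fun n : ℕ => symL2 d H n) 2 n)) := by
    refine .iUnion fun n => ?_
    have : SecondCountableTopology (symL2 d H n) :=
      TopologicalSpace.Subtype.secondCountableTopology _
    exact TopologicalSpace.isSeparable_range (ContinuousLinearMap.continuous _)
  refine TopologicalSpace.isSeparable_univ_iff.1 ((hsep.span (R := ℂ)).closure.mono fun f _ => ?_)
  refine mem_closure_of_tendsto (lp.hasSum_single (p := 2) (by norm_num) f)
    (Eventually.of_forall fun s => Submodule.sum_mem _ fun n _ => ?_)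
  exact Submodule.subset_span (Set.mem_iUnion.2 ⟨n, f n, by simp⟩)

/-- The `n`-boson component as a bounded linear map into `L²((ℝ^d)^n; H)`, which allows
components to be taken under integrals. -/
noncomputable def compCLM (d : ℕ) (H : Type*) [NormedAddCommGroup H] [InnerProductSpace ℂ H]
    (n : ℕ) : Fock d H →L[ℂ] Lp H 2 (volume : Measure (Fin n → Mom d)) :=
  (symL2 d H n).subtypeL.comp (lp.evalCLM ℂ (fun n : ℕ => symL2 d H n) 2 n)

theorem coeFn_compCLM (Ψ : Fock d H) (n : ℕ) : ⇑(compCLM d H n Ψ) = comp Ψ n := rfl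

theorem enorm_sq_eq_tsum_compCLM (Ψ : Fock d H) : ‖Ψ‖ₑ ^ 2 = ∑' n, ‖compCLM d H n Ψ‖ₑ ^ 2 :=
  enorm_sq_eq_tsum_lp Ψ

theorem eLpNorm_comp (Ψ : Fock d H) (n : ℕ) : eLpNorm (comp Ψ n) 2 volume = ‖Ψ n‖ₑ :=
  (Lp.enorm_def (compCLM d H n Ψ)).symm

theorem measurePreserving_cons (d n : ℕ) :
    MeasurePreserving (fun p : Mom d × (Fin n → Mom d) => (Fin.cons p.1 p.2 : Fin (n + 1) → Mom d))
      (volume.prod volume) volume := by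
  have h := (volume_preserving_piFinSuccAbove (fun _ : Fin (n + 1) => Mom d) 0).symm
  have hcons : ⇑(MeasurableEquiv.piFinSuccAbove (fun _ : Fin (n + 1) => Mom d) 0).symm =
      fun p => (Fin.cons p.1 p.2 : Fin (n + 1) → Mom d) := by
    funext p
    simp [MeasurableEquiv.piFinSuccAbove_symm_apply, Fin.insertNthEquiv]
  exact hcons ▸ h

/-- The `(n+1)`-boson component as a function of two variables, the first momentum and the `n`
other ones. -/
noncomputable def splitComp (Ψ : Fock d H) (n : ℕ) (p : Mom d × (Fin n → Mom d)) : H :=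
  comp Ψ (n + 1) (Fin.cons p.1 p.2)

theorem memLp_splitComp (Ψ : Fock d H) (n : ℕ) :
    MemLp (splitComp Ψ n) 2 (volume.prod volume) :=
  (memLp_comp Ψ (n + 1)).comp_measurePreserving (measurePreserving_cons d n)

theorem eLpNorm_splitComp (Ψ : Fock d H) (n : ℕ) :
    eLpNorm (splitComp Ψ n) 2 (volume.prod volume) = ‖Ψ (n + 1)‖ₑ := by
  rw [← eLpNorm_comp]
  exact eLpNorm_comp_measurePreserving (memLp_comp Ψ (n + 1)).1 (measurePreserving_cons d n)

/-! ### The number operator -/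

theorem enorm_ofReal_sqrt_natCast_sq (n : ℕ) : ‖((√n : ℝ) : ℂ)‖ₑ ^ 2 = n := by
  rw [← ofReal_norm, ← ENNReal.ofReal_pow (norm_nonneg _), Complex.norm_real, Real.norm_eq_abs,
    sq_abs, Real.sq_sqrt (Nat.cast_nonneg n), ENNReal.ofReal_natCast]

theorem mem_mulGraph_const_iff {c : ℕ → ℝ} {Ψ Φ : Fock d H} :
    (Ψ, Φ) ∈ mulGraph (fun n _ => c n) ↔ ∀ n, Φ n = (c n : ℂ) • Ψ n := by
  refine forall_congr' fun n => ?_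
  have hsmul : comp ((c n : ℂ) • Ψ) n =ᵐ[volume] fun k => (c n : ℂ) • comp Ψ n k :=
    comp_smul (c n : ℂ) Ψ n
  constructor
  · intro h
    exact Subtype.ext (Lp.ext (EventuallyEq.trans h hsmul.symm))
  · intro h
    have hcomp : comp Φ n = comp ((c n : ℂ) • Ψ) n := by
      rw [comp, h]
      rfl
    exact hcomp ▸ hsmul

theorem mem_domain_mulOp_const_iff {c : ℕ → ℝ} {Ψ : Fock d H} :
    Ψ ∈ (mulOp (fun n _ => c n) : Fock d H →ₗ.[ℂ] Fock d H).domain ↔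
      ∑' n, ‖(c n : ℂ)‖ₑ ^ 2 * ‖Ψ n‖ₑ ^ 2 < ⊤ := by
  simp only [LinearPMap.mem_domain_iff, mulOp_graph, mem_mulGraph_const_iff, ← mul_pow,
    ← enorm_smul]
  rw [← memℓp_two_iff_tsum_enorm_sq_lt_top (f := fun n => (c n : ℂ) • Ψ n)]
  constructor
  · rintro ⟨Φ, hΦ⟩
    exact (funext hΦ) ▸ lp.memℓp Φ
  · intro h
    exact ⟨⟨_, h⟩, fun n => rfl⟩

theorem mem_domain_sqrtNumberOp_iff {Ψ : Fock d H} :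
    Ψ ∈ (sqrtNumberOp d H).domain ↔ ∑' n : ℕ, (n : ℝ≥0∞) * ‖Ψ n‖ₑ ^ 2 < ⊤ := by
  have hop : sqrtNumberOp d H = mulOp fun n _ => √(n : ℝ) := by
    simp [sqrtNumberOp, sqrtDGamma]
  simp only [hop, mem_domain_mulOp_const_iff, enorm_ofReal_sqrt_natCast_sq]

/-! ### Annihilation operators -/

/-- The `n`-boson component of the formal vector `a(q) Ψ`, that is `√(n+1) Ψ⁽ⁿ⁺¹⁾(q, ·)`. It lies
in `L²` for almost every `q`, even if no square integrable `a(q) Ψ` exists, and `a(f) Ψ` is its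
integral against `conj f`. -/
noncomputable def annihilationKernel (Ψ : Fock d H) (n : ℕ) (q : Mom d) :
    Lp H 2 (volume : Measure (Fin n → Mom d)) :=
  ((√((n + 1 : ℕ) : ℝ) : ℝ) : ℂ) • sliceLp volume (splitComp Ψ n) q

theorem annihilationKernel_eq_smul (Ψ : Fock d H) (n : ℕ) : annihilationKernel Ψ n =
    ((√((n + 1 : ℕ) : ℝ) : ℝ) : ℂ) • sliceLp volume (splitComp Ψ n) := rfl

theorem eLpNorm_annihilationKernel_sq (Ψ : Fock d H) (n : ℕ) :
    eLpNorm (annihilationKernel Ψ n) 2 volume ^ 2 = (n + 1 : ℕ) * ‖Ψ (n + 1)‖ₑ ^ 2 := by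
  rw [annihilationKernel_eq_smul, eLpNorm_const_smul, mul_pow, enorm_ofReal_sqrt_natCast_sq,
    eLpNorm_sliceLp (memLp_splitComp Ψ n), eLpNorm_splitComp]

variable [CompleteSpace H] [TopologicalSpace.SeparableSpace H]

theorem memLp_annihilationKernel (Ψ : Fock d H) (n : ℕ) :
    MemLp (annihilationKernel Ψ n) 2 volume := by
  rw [annihilationKernel_eq_smul]
  exact (memLp_sliceLp ℂ (memLp_splitComp Ψ n)).const_smul _

theorem compCLM_eq_integral_annihilationKernel {f : Lp ℂ 2 (volume : Measure (Mom d))}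
    {Ψ Φ : Fock d H} (h : (Ψ, Φ) ∈ (annihilation f : Fock d H →ₗ.[ℂ] Fock d H).graph) (n : ℕ) :
    compCLM d H n Φ = ∫ q, conj (f q) • annihilationKernel Ψ n q := by
  rw [annihilation_graph] at h
  have hcomp : compCLM d H n Φ =ᵐ[volume] fun y =>
      ∫ q, (((√((n + 1 : ℕ) : ℝ) : ℝ) : ℂ) * conj (f q)) • splitComp Ψ n (q, y) := by
    filter_upwards [h n] with y hy
    simp only [coeFn_compCLM, hy, ← integral_smul, smul_smul, Nat.cast_add, Nat.cast_one, splitComp]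
  have hf : MemLp (fun q => ((√((n + 1 : ℕ) : ℝ) : ℝ) : ℂ) * conj (f q)) 2 volume :=
    (Lp.memLp f).star.const_mul _
  rw [eq_integral_smul_sliceLp (memLp_splitComp Ψ n) hf hcomp]
  simp only [annihilationKernel, smul_smul, mul_comm]

end Fock

/-! ### The pull-through formula -/

section PullThrough

variable {d : ℕ} {H : Type*} [NormedAddCommGroup H] [InnerProductSpace ℂ H]

/-- The operator-theoretical pull-through formula `a(f) Ψ = -∫ conj (f k) K(k) dk` for all test
functions `f ∈ C_c^∞(ℝ^d ∖ {0})`. Membership in the graph includes `Ψ ∈ D(a(f))`. -/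
def PullThroughFormula (Ψ : Fock d H) (K : Mom d → Fock d H) : Prop :=
  ∀ f : Mom d → ℂ, ContDiff ℝ (⊤ : ℕ∞) f → HasCompactSupport f → 0 ∉ tsupport f →
    ∀ hf : MemLp f 2 volume, (Ψ, -∫ k, conj (f k) • K k) ∈
      (annihilation (hf.toLp f) : Fock d H →ₗ.[ℂ] Fock d H).graph

variable [CompleteSpace H] [TopologicalSpace.SeparableSpace H] {Ψ : Fock d H}
  {K : Mom d → Fock d H}

theorem PullThroughFormula.integral_smul_annihilationKernel (h : PullThroughFormula Ψ K)
    {g : Mom d → ℝ} (hg : ContDiff ℝ (⊤ : ℕ∞) g) (hgc : HasCompactSupport g)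
    (hg0 : 0 ∉ tsupport g) (n : ℕ) :
    ∫ q, g q • annihilationKernel Ψ n q = -compCLM d H n (∫ q, g q • K q) := by
  have hsupp : tsupport (fun q => (g q : ℂ)) = tsupport g :=
    congrArg closure (Set.ext fun q => by simp)
  have hcont : ContDiff ℝ (⊤ : ℕ∞) fun q => (g q : ℂ) := Complex.ofRealCLM.contDiff.comp hg
  have hc : HasCompactSupport fun q => (g q : ℂ) := hgc.comp_left Complex.ofReal_zero
  have hL : MemLp (fun q => (g q : ℂ)) 2 volume := hcont.continuous.memLp_of_hasCompactSupport hc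
  have hpt := compCLM_eq_integral_annihilationKernel (h _ hcont hc (hsupp ▸ hg0) hL) n
  simp only [Complex.conj_ofReal, Complex.coe_smul, map_neg] at hpt
  refine Eq.trans (integral_congr_ae ?_) hpt.symm
  filter_upwards [hL.coeFn_toLp] with q hq
  rw [hq, Complex.conj_ofReal]
  rfl

theorem PullThroughFormula.integral_smul_compCLM_add_eq_zero (h : PullThroughFormula Ψ K)
    (hK : LocallyIntegrableOn K {0}ᶜ volume)
    {g : Mom d → ℝ} (hg : ContDiff ℝ (⊤ : ℕ∞) g) (hgc : HasCompactSupport g)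
    (hg0 : tsupport g ⊆ {0}ᶜ) (n : ℕ) :
    ∫ q, g q • (compCLM d H n (K q) + annihilationKernel Ψ n q) = 0 := by
  have hgK : Integrable (fun q => g q • K q) volume :=
    integrable_smul_of_tsupport_subset hK hg.continuous hgc hg0
  have hgL : MemLp g 2 volume := hg.continuous.memLp_of_hasCompactSupport hgc
  have hga : Integrable (fun q => g q • annihilationKernel Ψ n q) volume :=
    memLp_one_iff_integrable.1 ((memLp_annihilationKernel Ψ n).smul (r := 1) hgL)
  have hsmul : ∀ q, compCLM d H n (g q • K q) = g q • compCLM d H n (K q) := fun q =>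
    map_real_smul (compCLM d H n) (compCLM d H n).continuous (g q) (K q)
  have hcomp : ∫ q, g q • compCLM d H n (K q) = compCLM d H n (∫ q, g q • K q) := by
    simp only [← hsmul]
    exact (compCLM d H n).integral_comp_comm hgK
  have hgcomp : Integrable (fun q => g q • compCLM d H n (K q)) volume := by
    simpa only [hsmul] using (compCLM d H n).integrable_comp hgK
  simp only [smul_add]
  rw [integral_add hgcomp hga, hcomp,
    h.integral_smul_annihilationKernel hg hgc (fun h0 => hg0 h0 rfl), add_neg_cancel]

theorem PullThroughFormula.ae_compCLM_eq [NeZero d] (h : PullThroughFormula Ψ K)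
    (hK : LocallyIntegrableOn K {0}ᶜ volume) (n : ℕ) :
    ∀ᵐ q, compCLM d H n (K q) = -annihilationKernel Ψ n q := by
  have hloc : LocallyIntegrableOn (fun q => compCLM d H n (K q) + annihilationKernel Ψ n q)
      {0}ᶜ volume :=
    LocallyIntegrableOn.add (fun x hx => (hK x hx).imp fun t ht =>
        ⟨ht.1, (compCLM d H n).integrable_comp ht.2⟩)
      (((memLp_annihilationKernel Ψ n).locallyIntegrable one_le_two).locallyIntegrableOn _)
  have hzero := isOpen_compl_singleton.ae_eq_zero_of_integral_contDiff_smul_eq_zero hloc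
    fun g hg hgc hg0 => h.integral_smul_compCLM_add_eq_zero hK hg hgc hg0 n
  filter_upwards [hzero, Measure.ae_ne volume 0] with q hq hq0
  exact eq_neg_of_add_eq_zero_left (hq hq0)

theorem PullThroughFormula.eLpNorm_sq_eq_tsum [NeZero d] (h : PullThroughFormula Ψ K)
    (hK : LocallyIntegrableOn K {0}ᶜ volume) (hKm : AEStronglyMeasurable K volume) :
    eLpNorm K 2 volume ^ 2 = ∑' n : ℕ, (n : ℝ≥0∞) * ‖Ψ n‖ₑ ^ 2 := by
  have hcomp : ∀ n : ℕ, ∫⁻ q, ‖compCLM d H n (K q)‖ₑ ^ 2 =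
      ((n + 1 : ℕ) : ℝ≥0∞) * ‖Ψ (n + 1)‖ₑ ^ 2 := fun n => by
    rw [← eLpNorm_annihilationKernel_sq, eLpNorm_two_sq]
    refine lintegral_congr_ae ?_
    filter_upwards [h.ae_compCLM_eq hK n] with q hq
    rw [hq, enorm_neg]
  simp only [eLpNorm_two_sq, enorm_sq_eq_tsum_compCLM]
  rw [lintegral_tsum fun n =>
    ((compCLM d H n).continuous.comp_aestronglyMeasurable hKm).enorm.pow_const 2]
  rw [tsum_congr hcomp, tsum_eq_zero_add' (f := fun n : ℕ => (n : ℝ≥0∞) * ‖Ψ n‖ₑ ^ 2)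
    ENNReal.summable, Nat.cast_zero, zero_mul, zero_add]

theorem PullThroughFormula.mem_domain_sqrtNumberOp_iff [NeZero d] (h : PullThroughFormula Ψ K)
    (hK : LocallyIntegrableOn K {0}ᶜ volume) (hKm : AEStronglyMeasurable K volume) :
    Ψ ∈ (sqrtNumberOp d H).domain ↔ MemLp K 2 volume := by
  rw [QFT.mem_domain_sqrtNumberOp_iff, ← h.eLpNorm_sq_eq_tsum hK hKm,
    memLp_two_iff_eLpNorm_sq_lt_top hKm]

end PullThrough

/-! ### Maximal Carleman operators -/

section Carleman

variable {d : ℕ} {F : Type*} [NormedAddCommGroup F] [InnerProductSpace ℂ F] {K : Mom d → F}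

theorem applyPMap_of_mem {G : Type*} [NormedAddCommGroup G] [InnerProductSpace ℂ G]
    (S : F →ₗ.[ℂ] G) {x : F} (h : x ∈ S.domain) : applyPMap S x = S ⟨x, h⟩ := dif_pos h

theorem enorm_carleman (x : (carleman K).domain) :
    ‖carleman K x‖ₑ = eLpNorm (fun k => inner ℂ (K k) (x : F)) 2 volume :=
  Lp.enorm_toLp x.2

theorem enorm_carleman_le (x : (carleman K).domain) :
    ‖carleman K x‖ₑ ≤ eLpNorm K 2 volume * ‖(x : F)‖ₑ :=
  (enorm_carleman x).trans_le (eLpNorm_inner_le K x 2)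

theorem opENorm_carleman_le (K : Mom d → F) : opENorm (carleman K) ≤ eLpNorm K 2 volume := by
  refine iSup₂_le fun x hx => (enorm_carleman_le x).trans (mul_le_of_le_one_right' ?_)
  rw [← ofReal_norm]
  exact ENNReal.ofReal_le_one.2 hx

theorem carleman_domain_eq_top (hK : MemLp K 2 volume) : (carleman K).domain = ⊤ :=
  eq_top_iff.2 fun x _ => ⟨hK.1.inner aestronglyMeasurable_const,
    (eLpNorm_inner_le K x 2).trans_lt (ENNReal.mul_lt_top hK.2 enorm_lt_top)⟩

theorem isBddPMap_carleman (hK : MemLp K 2 volume) : IsBddPMap (carleman K) := by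
  refine ⟨(eLpNorm K 2 volume).toReal, fun x => ?_⟩
  have h := ENNReal.toReal_mono (ENNReal.mul_ne_top hK.2.ne enorm_ne_top) (enorm_carleman_le x)
  rwa [ENNReal.toReal_mul, toReal_enorm, toReal_enorm] at h

variable [TopologicalSpace.SeparableSpace F]

theorem eLpNorm_sq_eq_tsum_carleman (hK : AEStronglyMeasurable K volume)
    (hdom : (carleman K).domain = ⊤) {ι : Type*} (b : HilbertBasis ι ℂ F) :
    eLpNorm K 2 volume ^ 2 = ∑' i, ‖applyPMap (carleman K) (b i)‖ₑ ^ 2 := by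
  have : Countable ι := countable_of_orthonormal b.orthonormal
  simp only [eLpNorm_two_sq, enorm_sq_eq_tsum_enorm_inner_sq b]
  rw [lintegral_tsum fun i => (hK.inner aestronglyMeasurable_const).enorm.pow_const 2]
  refine tsum_congr fun i => ?_
  have hi : b i ∈ (carleman K).domain := hdom ▸ Submodule.mem_top
  rw [applyPMap_of_mem _ hi, enorm_carleman, eLpNorm_two_sq]

theorem isHilbertSchmidt_carleman_iff [CompleteSpace F] (hK : AEStronglyMeasurable K volume) :
    IsHilbertSchmidt (carleman K) ↔ MemLp K 2 volume := by
  constructor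
  · rintro ⟨hdom, -, w, b, hb⟩
    rw [memLp_two_iff_eLpNorm_sq_lt_top hK, eLpNorm_sq_eq_tsum_carleman hK hdom b]
    exact summable_norm_sq_iff_tsum_enorm_sq_lt_top.1 hb
  · intro h
    have hdom := carleman_domain_eq_top h
    obtain ⟨w, b, -⟩ := exists_hilbertBasis ℂ F
    refine ⟨hdom, isBddPMap_carleman h, w, b, summable_norm_sq_iff_tsum_enorm_sq_lt_top.2 ?_⟩
    rw [← eLpNorm_sq_eq_tsum_carleman hK hdom b]
    exact (memLp_two_iff_eLpNorm_sq_lt_top hK).1 h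

end Carleman

/-! ### The pull-through kernel -/

section Kernel

variable {d : ℕ} {F : Type*} [NormedAddCommGroup F] [InnerProductSpace ℂ F]
  {S : F →ₗ.[ℂ] F} {w : Mom d → ℝ} {B : Mom d → F →ₗ.[ℂ] F} {Ψ : F}

theorem pullThroughKernel_eq {k : Mom d} (h : Ψ ∈ (B k).domain) : pullThroughKernel S w B Ψ k =
    resolventAt S ((groundEnergy S - w k : ℝ) : ℂ) (applyPMap (B k) Ψ) := by
  rw [pullThroughKernel, applyPMap_of_mem (pullThroughOp S w B k) (x := Ψ) h, applyPMap_of_mem _ h]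
  rfl

theorem aestronglyMeasurable_pullThroughKernel [NeZero d] [CompleteSpace F]
    [TopologicalSpace.SeparableSpace F] (hS : BddBelow (realSpectrum S))
    (hw : AEMeasurable w volume) (hpos : ∀ k, k ≠ 0 → 0 < w k)
    (hΨ : ∀ k, k ≠ 0 → Ψ ∈ (B k).domain)
    (hB : ∀ Φ : F, AEMeasurable (fun k => inner ℂ Φ (applyPMap (B k) Ψ)) volume) :
    AEStronglyMeasurable (pullThroughKernel S w B Ψ) volume := by
  have hne : ∀ᵐ k : Mom d, k ≠ 0 := Measure.ae_ne volume 0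
  have hR := aestronglyMeasurable_resolventAt_groundEnergy_sub hS hw (hne.mono hpos)
  have hBΨ : AEStronglyMeasurable (fun k => applyPMap (B k) Ψ) volume :=
    aestronglyMeasurable_of_forall_inner (𝕜 := ℂ) fun Φ => (hB Φ).aestronglyMeasurable
  refine (isBoundedBilinearMap_apply.continuous.comp_aestronglyMeasurable
    (hR.prodMk hBΨ)).congr ?_
  filter_upwards [hne] with k hk
  exact (pullThroughKernel_eq (hΨ k hk)).symm

theorem enorm_pullThroughKernel_le (hn : ‖Ψ‖ ≤ 1) {k : Mom d} (h : Ψ ∈ (B k).domain) :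
    ‖pullThroughKernel S w B Ψ k‖ₑ ≤ opENorm (pullThroughOp S w B k) := by
  rw [pullThroughKernel, applyPMap_of_mem (pullThroughOp S w B k) (x := Ψ) h]
  exact le_iSup₂_of_le (⟨Ψ, h⟩ : (pullThroughOp S w B k).domain) hn le_rfl

theorem pullThroughBound_sq (S : F →ₗ.[ℂ] F) (w : Mom d → ℝ) (B : Mom d → F →ₗ.[ℂ] F) (ε : ℝ) :
    pullThroughBound S w B ε ^ 2 =
      ∫⁻ k in {k : Mom d | ε < ‖k‖}, opENorm (pullThroughOp S w B k) ^ 2 := by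
  rw [pullThroughBound, ← ENNReal.rpow_natCast, ← ENNReal.rpow_mul]
  norm_num

theorem antitone_pullThroughBound (S : F →ₗ.[ℂ] F) (w : Mom d → ℝ) (B : Mom d → F →ₗ.[ℂ] F) :
    Antitone (pullThroughBound S w B) := fun _ _ h =>
  ENNReal.rpow_le_rpow (lintegral_mono_set fun _ hk => lt_of_le_of_lt h hk) (by norm_num)

theorem eLpNorm_restrict_pullThroughKernel_le (hn : ‖Ψ‖ ≤ 1)
    (hΨ : ∀ k, k ≠ 0 → Ψ ∈ (B k).domain) {ε : ℝ} (hε : 0 < ε) :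
    eLpNorm (pullThroughKernel S w B Ψ) 2 (volume.restrict {k | ε < ‖k‖}) ≤
      pullThroughBound S w B ε := by
  refine (ENNReal.pow_le_pow_left_iff two_ne_zero).1 ?_
  rw [eLpNorm_two_sq, pullThroughBound_sq]
  refine setLIntegral_mono' (measurableSet_lt measurable_const measurable_norm) fun k hk => ?_
  gcongr
  exact enorm_pullThroughKernel_le hn (hΨ k (norm_pos_iff.1 (hε.trans hk)))

theorem eLpNorm_pullThroughKernel_le_of_tendsto [NeZero d] (hn : ‖Ψ‖ ≤ 1)
    (hΨ : ∀ k, k ≠ 0 → Ψ ∈ (B k).domain)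
    (hK : AEStronglyMeasurable (pullThroughKernel S w B Ψ) volume) {M₀ : ℝ≥0∞}
    (hM : Tendsto (pullThroughBound S w B) (𝓝[>] 0) (𝓝 M₀)) :
    eLpNorm (pullThroughKernel S w B Ψ) 2 volume ≤ M₀ := by
  refine le_of_tendsto_of_tendsto (tendsto_eLpNorm_restrict_of_aecover (aecover_lt_norm volume) hK
    two_ne_zero ENNReal.ofNat_ne_top) hM ?_
  filter_upwards [self_mem_nhdsWithin] with ε hε
  exact eLpNorm_restrict_pullThroughKernel_le hn hΨ hε

theorem locallyIntegrableOn_pullThroughKernel (hn : ‖Ψ‖ ≤ 1)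
    (hΨ : ∀ k, k ≠ 0 → Ψ ∈ (B k).domain)
    (hK : AEStronglyMeasurable (pullThroughKernel S w B Ψ) volume)
    (hM : ∀ ε : ℝ, 0 < ε → pullThroughBound S w B ε < ⊤) :
    LocallyIntegrableOn (pullThroughKernel S w B Ψ) {0}ᶜ volume :=
  locallyIntegrableOn_compl_zero_of_memLp_restrict one_le_two fun ε hε =>
    ⟨hK.restrict, (eLpNorm_restrict_pullThroughKernel_le hn hΨ hε).trans_lt (hM ε hε)⟩

end Kernel

end QFT

theorem theorem3_general {d : ℕ} (hd : 0 < d)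
    {H : Type*} [NormedAddCommGroup H] [InnerProductSpace ℂ H] [CompleteSpace H]
    [TopologicalSpace.SeparableSpace H]
    {S : Fock d H →ₗ.[ℂ] Fock d H} (hS : BddBelow (realSpectrum S))
    {ω : Mom d → ℝ} (hω : AEMeasurable ω volume) (hωpos : ∀ k, k ≠ 0 → 0 < ω k)
    {Ψ : Fock d H} (hΨ : ‖Ψ‖ ≤ 1) {B : Mom d → Fock d H →ₗ.[ℂ] Fock d H}
    (hBdom : ∀ k, k ≠ 0 → Ψ ∈ (B k).domain)
    (hBmeas : ∀ Φ : Fock d H, AEMeasurable (fun k => inner ℂ Φ (applyPMap (B k) Ψ)) volume)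
    (hOPPT : PullThroughFormula Ψ (pullThroughKernel S ω B Ψ))
    (hM : ∀ ε : ℝ, 0 < ε → pullThroughBound S ω B ε < ⊤) :
    List.TFAE
        [Ψ ∈ (sqrtNumberOp d H).domain,
          MemLp (fun k => ‖pullThroughKernel S ω B Ψ k‖) 2 volume,
          IsHilbertSchmidt (carleman (pullThroughKernel S ω B Ψ))] ∧
      (IsHilbertSchmidt (carleman (pullThroughKernel S ω B Ψ)) →
        ∃ M₀ : ENNReal, Tendsto (pullThroughBound S ω B) (𝓝[>] 0) (𝓝 M₀) ∧
          opENorm (carleman (pullThroughKernel S ω B Ψ)) ≤ M₀ ∧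
          opENorm (carleman (pullThroughKernel S ω B Ψ)) < ⊤) := by
  have : NeZero d := ⟨hd.ne'⟩
  have hK := aestronglyMeasurable_pullThroughKernel hS hω hωpos hBdom hBmeas
  have hloc := locallyIntegrableOn_pullThroughKernel hΨ hBdom hK hM
  refine ⟨?_, fun hHS => ?_⟩
  · rw [hOPPT.mem_domain_sqrtNumberOp_iff hloc hK, memLp_norm_iff hK,
      isHilbertSchmidt_carleman_iff hK]
    tfae_finish
  · have hlim := ((antitone_pullThroughBound S ω B).antitoneOn _).tendsto_nhdsGT (x := 0)
      ⟨⊤, fun _ _ => le_top⟩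
    exact ⟨_, hlim, (opENorm_carleman_le _).trans
        (eLpNorm_pullThroughKernel_le_of_tendsto hΨ hBdom hK hlim),
      (opENorm_carleman_le _).trans_lt ((isHilbertSchmidt_carleman_iff hK).1 hHS).2⟩

theorem theorem3 {d : ℕ} (hd : 0 < d)
    {H : Type*} [NormedAddCommGroup H] [InnerProductSpace ℂ H] [CompleteSpace H]
    [TopologicalSpace.SeparableSpace H]
    (A : H →ₗ.[ℂ] H) (hA : IsSelfAdjoint A) (hAbdd : IsSemibounded A)
    (ω : Mom d → ℝ) (hω : Continuous ω) (hω0 : ∀ k, 0 ≤ ω k) (hωpos : ∀ k, k ≠ 0 → 0 < ω k)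
    (hωinf : ∀ ε : ℝ, 0 < ε → ∃ c : ℝ, 0 < c ∧ ∀ k, ε < ‖k‖ → c ≤ ω k)
    -- the interaction Hamiltonian and the total Hamiltonian
    (HI HQFT : Fock d H →ₗ.[ℂ] Fock d H) (hHQFT : HQFT = freeHamiltonian A ω + HI)
    (hsa : IsSelfAdjoint HQFT) (hdom : HQFT.domain = (freeHamiltonian A ω).domain)
    -- the ground state
    (Ψ : Fock d H) (hΨ : IsGroundState HQFT Ψ)
    -- the pull-through operators
    (B : Mom d → Fock d H →ₗ.[ℂ] Fock d H)
    (hBdom : ∀ k, k ≠ 0 → (freeHamiltonian A ω).domain ≤ (B k).domain)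
    (hBmeas : ∀ Υ ∈ (freeHamiltonian A ω).domain, ∀ Φ : Fock d H,
      AEMeasurable (fun k => inner ℂ Φ (applyPMap (B k) Υ)) volume)
    -- the operator-theoretical pull-through formula
    (hOPPT : ∀ f : Mom d → ℂ, ContDiff ℝ (⊤ : ℕ∞) f → HasCompactSupport f → 0 ∉ tsupport f →
      ∀ hf : MemLp f 2 volume,
        (Ψ, -∫ k, starRingEnd ℂ (f k) • pullThroughKernel HQFT ω B Ψ k) ∈
          (annihilation (hf.toLp f) : Fock d H →ₗ.[ℂ] Fock d H).graph)
    (hRBbdd : ∀ k, k ≠ 0 → IsBddPMap (pullThroughOp HQFT ω B k))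
    (hM : ∀ ε : ℝ, 0 < ε → pullThroughBound HQFT ω B ε < ⊤) :
    List.TFAE
        [Ψ ∈ (sqrtNumberOp d H).domain,
          MemLp (fun k => ‖pullThroughKernel HQFT ω B Ψ k‖) 2 volume,
          IsHilbertSchmidt (carleman (pullThroughKernel HQFT ω B Ψ))] ∧
      (IsHilbertSchmidt (carleman (pullThroughKernel HQFT ω B Ψ)) →
        ∃ M₀ : ENNReal, Tendsto (pullThroughBound HQFT ω B) (𝓝[>] 0) (𝓝 M₀) ∧
          opENorm (carleman (pullThroughKernel HQFT ω B Ψ)) ≤ M₀ ∧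
          opENorm (carleman (pullThroughKernel HQFT ω B Ψ)) < ⊤) := by
  have hΨ0 : Ψ ∈ (freeHamiltonian A ω).domain := hdom ▸ hΨ.eigen.1
  exact theorem3_general hd hΨ.bddBelow hω.measurable.aemeasurable hωpos hΨ.norm_eq_one.le
    (fun k hk => hBdom k hk hΨ0) (hBmeas Ψ hΨ0) hOPPT hM
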